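/- Let $(\mathcal{C},\mathbb{E},\mathfrak{s})$ be a small extriangulated category (in the sense of Nakaoka--Palu), and let $\{\mathbb{E}^i\}_{i\ge 1}$ be a family of higher extension groups of $\mathcal{C}$. By this we mean either the standard family given by $\mathbb{E}^1=\mathbb{E}$ and $\mathbb{E}^{i+1}(Z,A)=\int^{X\in\mathcal{C}}\mathbb{E}^i(X,A)\otimes_{\mathbb{Z}}\mathbb{E}(Z,X)$, or any family of additive bifunctors $\mathbb{E}^i:\mathcal{C}^{op}\times\mathcal{C}\to\mathrm{Ab}$, $i\ge1$, such that * $\mathbb{E}^1=\mathbb{E}$; * every $\mathbb{E}$-triangle $A\xrightarrow{x}B\xrightarrow{y}Z\overset{\delta}{\dashrightarrow}$ has, for all $i\geq 1$, natural transformations $\partial^i_\delta:\mathbb{E}^i(A,-)\to\mathbb{E}^{i+1}(Z,-)$ and $\Delta^i_\delta:\mathbb{E}^i(-,Z)\to\mathbb{E}^{i+1}(-,A)$ for which $\mathbb{E}^i(Z,-)\to\mathbb{E}^i(B,-)\to\mathbb{E}^i(A,-)\xrightarrow{\partial_\delta^i}\mathbb{E}^{i+1}(Z,-)$ and $\mathbb{E}^i(-,A)\to\mathbb{E}^i(-,B)\to\mathbb{E}^i(-,Z)\xrightarrow{\Delta_\delta^i}\mathbb{E}^{i+1}(-,A)$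 are exact; * $\partial$ and $\Delta$ are compatible with morphisms of $\mathbb{E}$-triangles; * $\mathbb{E}^i(f,-)=0$ for all $i\ge1$ whenever $\mathbb{E}(f,-)=0$, and $\mathbb{E}^i(-,g)=0$ for all $i\ge1$ whenever $\mathbb{E}(-,g)=0$. Let $n\ge 0$ and let $\mathcal{X}\subseteq\mathcal{C}$ be an $(n+2)$-rigid full subcategory, that is, $\mathbb{E}^i(X,X')=0$ for all $X,X'\in\mathcal{X}$ and $1\le i\le n+1$. For $m\ge0$ let $\mathcal{X}_m^\vee$ be the full subcategory of the objects $M$ that have, for some $0\le k\le m$, a finite $\mathcal{X}$-coresolution of length $k$: conflations $M_j\to Y_j\to M_{j+1}$ $(0\le j<k)$ with $M_0=M$ and $M_k\simeq Y_k$, where $Y_0,\dots,Y_k\in\mathcal{X}$. Let $\underline{\mathcal{X}_n^\vee}$ be the quotient of $\mathcal{X}_n^\vee$ by the ideal of the morphisms $f$ with $\mathbb{E}(f,-)=0$ on $\mathcal{C}$. Let $\mathsf{Mod}\,\underline{\mathcal{X}_n^\vee}$ be the category of additive contravariant functors $\underline{\mathcal{X}_n^\vee}\to\mathrm{Ab}$,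 and let $\mathrm{fp}\,\underline{\mathcal{X}_n^\vee}$ be its full subcategory of the cokernels of morphisms between finite coproducts of representable functors. Consider the additive functor $$\mathbb{H}:\mathcal{X}_{n+1}^\vee\to\mathsf{Mod}\,\underline{\mathcal{X}_n^\vee},\qquad M\mapsto\underline{\mathbb{E}}(-,M),$$ where $\underline{\mathbb{E}}(-,M)$ is induced by the restriction of $\mathbb{E}(-,M)$ to $\mathcal{X}_n^\vee$, and let $\mathcal{K}:=\mathrm{Ker}(\mathbb{H})$ be the ideal of the morphisms $h$ of $\mathcal{X}_{n+1}^\vee$ with $\mathbb{E}(-,h)|_{\mathcal{X}_n^\vee}=0$. Then $\mathbb{H}$ takes values in $\mathrm{fp}\,\underline{\mathcal{X}_n^\vee}$, and: (a) the induced additive functor $\mathbb{F}:\mathcal{X}_{n+1}^\vee/\mathcal{K}\to\mathrm{fp}\,\underline{\mathcal{X}_n^\vee}$ is full and faithful; (b) $\mathcal{K}=[\mathcal{X}]$, the class of the morphisms of $\mathcal{X}_{n+1}^\vee$ that factor through an object of $\mathcal{X}$. -/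

import Mathlib

open CategoryTheory CategoryTheory.Limits Opposite

universe u v

namespace Extri

/-! ### Ideals of preadditive categories and quotient categories -/

section Ideals

/-- A two-sided ideal of a preadditive category: a subgroup of every group of morphisms, stable
under composition with arbitrary morphisms on both sides. -/
structure CatIdeal (D : Type u) [Category.{v} D] [Preadditive D] where
  /-- the morphisms `X ⟶ Y` that belong to the ideal -/
  hom : ∀ X Y : D, AddSubgroup (X ⟶ Y)
  comp_left : ∀ {X Y Z : D} (f : X ⟶ Y) {g : Y ⟶ Z}, g ∈ hom Y Z → f ≫ g ∈ hom X Z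
  comp_right : ∀ {X Y Z : D} {f : X ⟶ Y} (g : Y ⟶ Z), f ∈ hom X Y → f ≫ g ∈ hom X Z

namespace CatIdeal

variable {D : Type u} [Category.{v} D] [Preadditive D] (I : CatIdeal D)

/-- The class of morphisms of an ideal. -/
def morphisms : MorphismProperty D := fun X Y f => f ∈ I.hom X Y

/-- Two parallel morphisms are identified when their difference lies in the ideal. -/
def rel : HomRel D := fun X Y f g => f - g ∈ I.hom X Y

instance : Congruence I.rel where
  comp_left {_ _ _} f {g g'} h := by
    have := I.comp_left f h
    rwa [Preadditive.comp_sub] at this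
  comp_right {_ _ _ _ _} g h := by
    have := I.comp_right g h
    rwa [Preadditive.sub_comp] at this
  equivalence :=
    { refl := fun f => by
        change f - f ∈ _
        rw [sub_self]
        exact zero_mem _
      symm := fun {f g} h => by
        change g - f ∈ _
        rw [← neg_sub]
        exact neg_mem h
      trans := fun {f g k} h₁ h₂ => by
        change f - k ∈ _
        rw [← sub_add_sub_cancel f g k]
        exact add_mem h₁ h₂ }

/-- The quotient category `D/I`: the objects are those of `D`, and the group of morphisms from
`X` to `Y` is `Hom(X, Y)/I(X, Y)`. -/
abbrev Quot : Type u := CategoryTheory.Quotient I.rel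

/-- The canonical functor `D ⥤ D/I`. -/
abbrev proj : D ⥤ I.Quot := CategoryTheory.Quotient.functor I.rel

lemma rel_add ⦃X Y : D⦄ (f₁ f₂ g₁ g₂ : X ⟶ Y) (hf : I.rel f₁ f₂) (hg : I.rel g₁ g₂) :
    I.rel (f₁ + g₁) (f₂ + g₂) := by
  change _ - _ ∈ _
  rw [add_sub_add_comm]
  exact add_mem hf hg

instance : Preadditive I.Quot := CategoryTheory.Quotient.preadditive I.rel I.rel_add

instance : I.proj.Additive := CategoryTheory.Quotient.functor_additive I.rel I.rel_add

end CatIdeal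

/-- The kernel of an additive functor: the ideal of the morphisms sent to zero. -/
def kerIdeal {D : Type u} [Category.{v} D] [Preadditive D] {D' : Type*} [Category* D']
    [Preadditive D'] (F : D ⥤ D') [F.Additive] : CatIdeal D where
  hom X Y := (F.mapAddHom : (X ⟶ Y) →+ (F.obj X ⟶ F.obj Y)).ker
  comp_left {X Y Z} f {g} h := by
    simp only [AddMonoidHom.mem_ker, Functor.coe_mapAddHom] at h ⊢
    rw [F.map_comp, h, comp_zero]
  comp_right {X Y Z f} g h := by
    simp only [AddMonoidHom.mem_ker, Functor.coe_mapAddHom] at h ⊢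
    rw [F.map_comp, h, zero_comp]

end Ideals

/-! ### Modules over a preadditive category -/

section Modules

variable (D : Type u) [Category.{u} D] [Preadditive D]

/-- Right `D`-modules: additive contravariant functors from `D` to abelian groups. -/
abbrev RightMod := Dᵒᵖ ⥤+ AddCommGrpCat.{u}

/-- A right `D`-module is finitely presented if it is the cokernel of a morphism between finite
coproducts of representable functors. Coproducts and cokernels of additive functors are
additive, so they are formed in the ambient category of functors. -/
def IsFinPres : ObjectProperty (RightMod D) := fun G =>
  ∃ (p q : ℕ) (P : Fin p → D) (Q : Fin q → D)
    (φ : (∐ fun i => preadditiveYoneda.obj (P i)) ⟶ (∐ fun j => preadditiveYoneda.obj (Q j))),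
    Nonempty (cokernel φ ≅ G.obj)

/-- The category of finitely presented right `D`-modules. -/
abbrev FinPresMod := (IsFinPres D).FullSubcategory

end Modules

/-! ### Bifunctors -/

section Bifunctors

variable {C : Type u} [SmallCategory C]

/-- The value `F(Z, A)` of a bifunctor, contravariant in `Z` and covariant in `A`. -/
abbrev val (F : Cᵒᵖ ⥤ C ⥤ AddCommGrpCat.{u}) (Z A : C) : Type u := (F.obj (op Z)).obj A

/-- The left action `η ↦ a · η = F(Z, a)(η)`. -/
abbrev push (F : Cᵒᵖ ⥤ C ⥤ AddCommGrpCat.{u}) {Z A A' : C} (a : A ⟶ A') :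
    val F Z A →+ val F Z A' := ((F.obj (op Z)).map a).hom

/-- The right action `η ↦ η · c = F(c, A)(η)`. -/
abbrev pull (F : Cᵒᵖ ⥤ C ⥤ AddCommGrpCat.{u}) {Z Z' A : C} (c : Z' ⟶ Z) :
    val F Z A →+ val F Z' A := ((F.map c.op).app A).hom

lemma push_id (F : Cᵒᵖ ⥤ C ⥤ AddCommGrpCat.{u}) {Z A : C} (η : val F Z A) :
    push F (𝟙 A) η = η := by
  dsimp only [push]
  rw [CategoryTheory.Functor.map_id]
  rfl

lemma pull_id (F : Cᵒᵖ ⥤ C ⥤ AddCommGrpCat.{u}) {Z A : C} (η : val F Z A) :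
    pull F (𝟙 Z) η = η := by
  dsimp only [pull]
  rw [op_id, CategoryTheory.Functor.map_id]
  rfl

lemma push_comp (F : Cᵒᵖ ⥤ C ⥤ AddCommGrpCat.{u}) {Z A A' A'' : C} (a : A ⟶ A') (a' : A' ⟶ A'')
    (η : val F Z A) : push F (a ≫ a') η = push F a' (push F a η) := by
  dsimp only [push]
  rw [CategoryTheory.Functor.map_comp]
  rfl

lemma pull_comp (F : Cᵒᵖ ⥤ C ⥤ AddCommGrpCat.{u}) {X Y Z A : C} (f : X ⟶ Y) (g : Y ⟶ Z)
    (η : val F Z A) : pull F (f ≫ g) η = pull F f (pull F g η) := by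
  dsimp only [pull]
  rw [op_comp, CategoryTheory.Functor.map_comp]
  rfl

section Coend

variable (F G : Cᵒᵖ ⥤ C ⥤ AddCommGrpCat.{u})

/-- Formal generators `η ⊗ θ` of the coend `∫^X F(X, A) ⊗ G(Z, X)`. -/
abbrev CoendGen (Z A : C) : Type u := Σ X : C, val F X A × val G Z X

/-- The defining relations of `∫^X F(X, A) ⊗ G(Z, X)`: the symbol `η ⊗ θ` is additive in each
variable, and `(η · f) ⊗ θ = η ⊗ (f · θ)` for every morphism `f`. -/
inductive CoendRel (Z A : C) : FreeAbelianGroup (CoendGen F G Z A) → Prop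
  | add_left (X : C) (η η' : val F X A) (θ : val G Z X) :
      CoendRel Z A (.of ⟨X, η + η', θ⟩ - .of ⟨X, η, θ⟩ - .of ⟨X, η', θ⟩)
  | add_right (X : C) (η : val F X A) (θ θ' : val G Z X) :
      CoendRel Z A (.of ⟨X, η, θ + θ'⟩ - .of ⟨X, η, θ⟩ - .of ⟨X, η, θ'⟩)
  | balanced (X Y : C) (f : X ⟶ Y) (η : val F Y A) (θ : val G Z X) :
      CoendRel Z A (.of ⟨X, pull F f η, θ⟩ - .of ⟨Y, η, push G f θ⟩)

/-- The subgroup generated by the defining relations. -/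
abbrev coendSub (Z A : C) : AddSubgroup (FreeAbelianGroup (CoendGen F G Z A)) :=
  AddSubgroup.closure {t | CoendRel F G Z A t}

/-- The coend `(F ◇ G)(Z, A) = ∫^X F(X, A) ⊗ G(Z, X)`. -/
abbrev CoendVal (Z A : C) : Type u := FreeAbelianGroup (CoendGen F G Z A) ⧸ coendSub F G Z A

/-- The action of `c : Z' ⟶ Z` and `a : A ⟶ A'` on generators:
`η ⊗ θ ↦ (a · η) ⊗ (θ · c)`. -/
def coendGenMap {Z Z' A A' : C} (c : Z' ⟶ Z) (a : A ⟶ A') (t : CoendGen F G Z A) :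
    CoendGen F G Z' A' := ⟨t.1, push F a t.2.1, pull G c t.2.2⟩

lemma push_pull {Z Z' A A' : C} (c : Z' ⟶ Z) (a : A ⟶ A') (η : val F Z A) :
    push F a (pull F c η) = pull F c (push F a η) :=
  (ConcreteCategory.congr_hom ((F.map c.op).naturality a) η).symm

lemma coendSub_le {Z Z' A A' : C} (c : Z' ⟶ Z) (a : A ⟶ A') :
    coendSub F G Z A ≤
      (coendSub F G Z' A').comap (FreeAbelianGroup.map (coendGenMap F G c a)) := by
  rw [AddSubgroup.closure_le]
  rintro t ht
  apply AddSubgroup.subset_closure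
  cases ht with
  | add_left X η η' θ =>
    have := CoendRel.add_left (F := F) (G := G) (Z := Z') (A := A') X (push F a η)
      (push F a η') (pull G c θ)
    simpa [coendGenMap, FreeAbelianGroup.map_of_apply] using this
  | add_right X η θ θ' =>
    have := CoendRel.add_right (F := F) (G := G) (Z := Z') (A := A') X (push F a η)
      (pull G c θ) (pull G c θ')
    simpa [coendGenMap, FreeAbelianGroup.map_of_apply] using this
  | balanced X Y f η θ =>
    have := CoendRel.balanced (F := F) (G := G) (Z := Z') (A := A') X Y f (push F a η)
      (pull G c θ)
    rw [push_pull, ← push_pull] at this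
    simpa [coendGenMap, FreeAbelianGroup.map_of_apply] using this

/-- The induced map on coends. -/
def coendMap {Z Z' A A' : C} (c : Z' ⟶ Z) (a : A ⟶ A') :
    CoendVal F G Z A →+ CoendVal F G Z' A' :=
  QuotientAddGroup.map _ _ (FreeAbelianGroup.map (coendGenMap F G c a)) (coendSub_le F G c a)

@[simp]
lemma coendMap_mk {Z Z' A A' : C} (c : Z' ⟶ Z) (a : A ⟶ A') (t : CoendGen F G Z A) :
    coendMap F G c a (QuotientAddGroup.mk (.of t)) =
      QuotientAddGroup.mk (.of (coendGenMap F G c a t)) := by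
  rw [coendMap, QuotientAddGroup.map_mk, FreeAbelianGroup.map_of_apply]

lemma coend_hom_ext {Z A : C} {H : Type*} [AddCommGroup H] {f g : CoendVal F G Z A →+ H}
    (h : ∀ t, f (QuotientAddGroup.mk (.of t)) = g (QuotientAddGroup.mk (.of t))) : f = g := by
  refine QuotientAddGroup.addMonoidHom_ext _ (FreeAbelianGroup.lift_ext _ _ fun t => ?_)
  exact h t

lemma coendMap_id (Z A : C) : coendMap F G (𝟙 Z) (𝟙 A) = AddMonoidHom.id _ := by
  refine coend_hom_ext F G fun t => ?_
  rw [coendMap_mk, AddMonoidHom.id_apply]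
  congr 2
  obtain ⟨X, η, θ⟩ := t
  simp only [coendGenMap, push_id, pull_id]

lemma coendMap_comp {Z Z' Z'' A A' A'' : C} (c : Z' ⟶ Z) (c' : Z'' ⟶ Z') (a : A ⟶ A')
    (a' : A' ⟶ A'') :
    coendMap F G (c' ≫ c) (a ≫ a') = (coendMap F G c' a').comp (coendMap F G c a) := by
  refine coend_hom_ext F G fun t => ?_
  rw [AddMonoidHom.comp_apply, coendMap_mk, coendMap_mk, coendMap_mk]
  congr 2
  obtain ⟨X, η, θ⟩ := t
  simp only [coendGenMap, push_comp, pull_comp]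
  rfl

/-- The bifunctor `F ◇ G`, `(F ◇ G)(Z, A) = ∫^X F(X, A) ⊗ G(Z, X)`. -/
def coendComp : Cᵒᵖ ⥤ C ⥤ AddCommGrpCat.{u} where
  obj Z :=
    { obj := fun A => AddCommGrpCat.of (CoendVal F G Z.unop A)
      map := fun a => AddCommGrpCat.ofHom (coendMap F G (𝟙 _) a)
      map_id := fun A => by
        rw [coendMap_id]
        rfl
      map_comp := fun a b => by
        rw [← AddCommGrpCat.ofHom_comp, ← coendMap_comp, Category.comp_id] }
  map c :=
    { app := fun A => AddCommGrpCat.ofHom (coendMap F G c.unop (𝟙 A))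
      naturality := fun A B a => by
        dsimp only
        rw [← AddCommGrpCat.ofHom_comp, ← AddCommGrpCat.ofHom_comp, ← coendMap_comp,
          ← coendMap_comp]
        simp }
  map_id Z := by
    ext A : 2
    dsimp only
    rw [unop_id, coendMap_id]
    rfl
  map_comp c c' := by
    ext A : 2
    dsimp only [NatTrans.comp_app]
    rw [← AddCommGrpCat.ofHom_comp, ← coendMap_comp, unop_comp, Category.comp_id]

end Coend

/-- A full subcategory `𝒳` is `(n+2)`-rigid with respect to a family of higher extension groups
if `Eⁱ(𝒳, 𝒳) = 0` for `1 ≤ i ≤ n + 1`. (The index of the family is shifted by one.) -/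
def IsRigid (X : ℕ → (Cᵒᵖ ⥤ C ⥤ AddCommGrpCat.{u})) (n : ℕ) (𝒳 : ObjectProperty C) : Prop :=
  ∀ i ≤ n, ∀ U V : C, 𝒳 U → 𝒳 V → ∀ η : val (X i) U V, η = 0

end Bifunctors

/-! ### Extriangulated categories -/

section Extriangulated

variable (C : Type u) [SmallCategory C]

/-- A sequence `A ⟶ B ⟶ Z` with fixed ends. -/
structure Seq {C : Type u} [SmallCategory C] (A Z : C) where
  /-- the middle term -/
  mid : C
  /-- the first morphism -/
  i : A ⟶ mid
  /-- the second morphism -/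
  p : mid ⟶ Z

/-- Two sequences with the same ends are equivalent if there is an isomorphism between the
middle terms that is compatible with the morphisms. -/
instance Seq.setoid {C : Type u} [SmallCategory C] (A Z : C) : Setoid (Seq A Z) where
  r S S' := ∃ b : S.mid ≅ S'.mid, S.i ≫ b.hom = S'.i ∧ b.hom ≫ S'.p = S.p
  iseqv :=
    { refl := fun S => ⟨Iso.refl _, by simp, by simp⟩
      symm := fun {S S'} ⟨b, h₁, h₂⟩ => ⟨b.symm, by simp [← h₁], by simp [← h₂]⟩
      trans := fun {S S' S''} ⟨b, h₁, h₂⟩ ⟨b', h₁', h₂'⟩ =>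
        ⟨b ≪≫ b', by simp [← h₁', ← h₁], by simp [← h₂, ← h₂']⟩ }

variable [Preadditive C] [HasBinaryBiproducts C]

/-- A biadditive bifunctor `E`, contravariant in the first and covariant in the second variable,
with a correspondence `s` that sends each element of `E(Z, A)` (an `E`-extension) to an
equivalence class of sequences `A ⟶ B ⟶ Z`. -/
structure PreExtriangulation where
  /-- the bifunctor -/
  E : Cᵒᵖ ⥤ C ⥤ AddCommGrpCat.{u}
  additive_left : E.Additive
  additive_right : ∀ Z : Cᵒᵖ, (E.obj Z).Additive
  /-- the correspondence -/
  s : ∀ {Z A : C}, val E Z A → Quotient (Seq.setoid A Z)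

namespace PreExtriangulation

variable {C} (T : PreExtriangulation C)

/-- The sequence `A ⟶ B ⟶ Z` realizes the extension `δ`, i.e. `s(δ) = [A ⟶ B ⟶ Z]`. Together
with `δ` it is then called an `E`-triangle. -/
def Realizes {A B Z : C} (x : A ⟶ B) (y : B ⟶ Z) (δ : val T.E Z A) : Prop :=
  T.s δ = Quotient.mk (Seq.setoid A Z) ⟨B, x, y⟩

/-- A conflation is a sequence that realizes some extension. -/
def Conflation {A B Z : C} (x : A ⟶ B) (y : B ⟶ Z) : Prop :=
  ∃ δ : val T.E Z A, T.Realizes x y δ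

/-- The direct sum `δ ⊕ δ' ∈ E(Z ⊕ Z', A ⊕ A')` of two extensions: the element with components
`(δ, 0, 0, δ')`. -/
noncomputable def extSum {A A' Z Z' : C} (δ : val T.E Z A) (δ' : val T.E Z' A') :
    val T.E (Z ⊞ Z') (A ⊞ A') :=
  pull T.E biprod.fst (push T.E biprod.inl δ) + pull T.E biprod.snd (push T.E biprod.inr δ')

end PreExtriangulation

/-- The structure of an extriangulated category on an additive category `C`. -/
structure Extriangulation extends PreExtriangulation C where
  /-- `s` is a realization: a morphism of extensions lifts to the realizing sequences. -/
  realization : ∀ {A B Z A' B' Z' : C} {x : A ⟶ B} {y : B ⟶ Z} {x' : A' ⟶ B'} {y' : B' ⟶ Z'}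
    {δ : val E Z A} {δ' : val E Z' A'}, toPreExtriangulation.Realizes x y δ →
    toPreExtriangulation.Realizes x' y' δ' → ∀ (a : A ⟶ A') (c : Z ⟶ Z'),
    push E a δ = pull E c δ' → ∃ b : B ⟶ B', x ≫ b = a ≫ x' ∧ y ≫ c = b ≫ y'
  /-- the zero extension is realized by the split sequence -/
  realizes_zero : ∀ A Z : C, toPreExtriangulation.Realizes (biprod.inl : A ⟶ A ⊞ Z)
    (biprod.snd : A ⊞ Z ⟶ Z) 0
  /-- realization is compatible with direct sums -/
  realizes_sum : ∀ {A B Z A' B' Z' : C} {x : A ⟶ B} {y : B ⟶ Z} {x' : A' ⟶ B'} {y' : B' ⟶ Z'}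
    {δ : val E Z A} {δ' : val E Z' A'}, toPreExtriangulation.Realizes x y δ →
    toPreExtriangulation.Realizes x' y' δ' →
    toPreExtriangulation.Realizes (biprod.map x x') (biprod.map y y')
      (toPreExtriangulation.extSum δ δ')
  /-- axiom (ET3) -/
  et3 : ∀ {A B Z A' B' Z' : C} {x : A ⟶ B} {y : B ⟶ Z} {x' : A' ⟶ B'} {y' : B' ⟶ Z'}
    {δ : val E Z A} {δ' : val E Z' A'}, toPreExtriangulation.Realizes x y δ →
    toPreExtriangulation.Realizes x' y' δ' → ∀ (a : A ⟶ A') (b : B ⟶ B'), x ≫ b = a ≫ x' →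
    ∃ c : Z ⟶ Z', push E a δ = pull E c δ' ∧ y ≫ c = b ≫ y'
  /-- axiom (ET3)ᵒᵖ -/
  et3_op : ∀ {A B Z A' B' Z' : C} {x : A ⟶ B} {y : B ⟶ Z} {x' : A' ⟶ B'} {y' : B' ⟶ Z'}
    {δ : val E Z A} {δ' : val E Z' A'}, toPreExtriangulation.Realizes x y δ →
    toPreExtriangulation.Realizes x' y' δ' → ∀ (b : B ⟶ B') (c : Z ⟶ Z'), y ≫ c = b ≫ y' →
    ∃ a : A ⟶ A', push E a δ = pull E c δ' ∧ x ≫ b = a ≫ x'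
  /-- axiom (ET4) -/
  et4 : ∀ {A B D G F : C} {f : A ⟶ B} {f' : B ⟶ D} {g : B ⟶ G} {g' : G ⟶ F}
    {δ : val E D A} {δ' : val E F B}, toPreExtriangulation.Realizes f f' δ →
    toPreExtriangulation.Realizes g g' δ' →
    ∃ (W : C) (h' : G ⟶ W) (d : D ⟶ W) (e : W ⟶ F) (δ'' : val E W A),
      g ≫ h' = f' ≫ d ∧ h' ≫ e = g' ∧ toPreExtriangulation.Realizes (f ≫ g) h' δ'' ∧
      toPreExtriangulation.Realizes d e (push E f' δ') ∧ pull E d δ'' = δ ∧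
      push E f δ'' = pull E e δ'
  /-- axiom (ET4)ᵒᵖ -/
  et4_op : ∀ {D A B F G : C} {f' : D ⟶ A} {f : A ⟶ B} {g' : F ⟶ B} {g : B ⟶ G}
    {δ : val E B D} {δ' : val E G F}, toPreExtriangulation.Realizes f' f δ →
    toPreExtriangulation.Realizes g' g δ' →
    ∃ (W : C) (h' : W ⟶ A) (d : D ⟶ W) (e : W ⟶ F) (δ'' : val E G W),
      d ≫ h' = f' ∧ h' ≫ f = e ≫ g' ∧ toPreExtriangulation.Realizes h' (f ≫ g) δ'' ∧
      toPreExtriangulation.Realizes d e (pull E g' δ) ∧ δ' = push E e δ'' ∧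
      push E d δ = pull E g δ''

variable {C} (T : Extriangulation C)

namespace Extriangulation

/-- `E`-projective morphisms: `E(f, -) = 0`. -/
def IsProjMor {X Y : C} (f : X ⟶ Y) : Prop := ∀ A : C, ∀ δ : val T.E Y A, pull T.E f δ = 0

/-- `E`-injective morphisms: `E(-, g) = 0`. -/
def IsInjMor {X Y : C} (g : X ⟶ Y) : Prop := ∀ Z : C, ∀ δ : val T.E Z X, push T.E g δ = 0

/-! #### Higher extension groups -/

/-- The higher extension bifunctors of the small extriangulated category, obtained by iterating
the composition of bifunctors: `E¹ = E` and `Eⁱ⁺¹(Z, A) = ∫^X Eⁱ(X, A) ⊗ E(Z, X)`.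
The index is shifted: `T.coendExt i` is `Eⁱ⁺¹`. -/
def coendExt : ℕ → (Cᵒᵖ ⥤ C ⥤ AddCommGrpCat.{u})
  | 0 => T.E
  | i + 1 => coendComp (coendExt i) T.E

/-- A family `Eⁱ`, `i ≥ 1`, of biadditive bifunctors is a family of higher extension groups of
the extriangulated category if it is equipped with connecting morphisms as below. The index is
shifted: `X i` is `Eⁱ⁺¹`. -/
structure HigherExtGroups (X : ℕ → (Cᵒᵖ ⥤ C ⥤ AddCommGrpCat.{u})) where
  additive_left : ∀ i, (X i).Additive
  additive_right : ∀ i (Z : Cᵒᵖ), ((X i).obj Z).Additive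
  /-- `E¹ = E` -/
  one : X 0 = T.E
  /-- the connecting morphism `∂ : Eⁱ(A, M) ⟶ Eⁱ⁺¹(Z, M)` of an extension `δ ∈ E(Z, A)` -/
  conn (i : ℕ) {Z A : C} (δ : val T.E Z A) (M : C) : val (X i) A M →+ val (X (i + 1)) Z M
  /-- the connecting morphism `Δ : Eⁱ(M, Z) ⟶ Eⁱ⁺¹(M, A)` of an extension `δ ∈ E(Z, A)` -/
  conn' (i : ℕ) {Z A : C} (δ : val T.E Z A) (M : C) : val (X i) M Z →+ val (X (i + 1)) M A
  /-- `∂` is natural in `M` -/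
  conn_natural : ∀ (i : ℕ) {Z A : C} (δ : val T.E Z A) {M N : C} (m : M ⟶ N)
    (η : val (X i) A M), push (X (i + 1)) m (conn i δ M η) = conn i δ N (push (X i) m η)
  /-- `Δ` is natural in `M` -/
  conn'_natural : ∀ (i : ℕ) {Z A : C} (δ : val T.E Z A) {M N : C} (m : M ⟶ N)
    (η : val (X i) N Z), pull (X (i + 1)) m (conn' i δ N η) = conn' i δ M (pull (X i) m η)
  /-- exactness of `Eⁱ(Z, -) ⟶ Eⁱ(B, -) ⟶ Eⁱ(A, -)` -/
  exact₁ : ∀ (i : ℕ) {A B Z : C} (x : A ⟶ B) (y : B ⟶ Z) (δ : val T.E Z A), T.Realizes x y δ →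
    ∀ M : C, Function.Exact (pull (X i) (A := M) y) (pull (X i) (A := M) x)
  /-- exactness of `Eⁱ(B, -) ⟶ Eⁱ(A, -) ⟶ Eⁱ⁺¹(Z, -)` -/
  exact₂ : ∀ (i : ℕ) {A B Z : C} (x : A ⟶ B) (y : B ⟶ Z) (δ : val T.E Z A), T.Realizes x y δ →
    ∀ M : C, Function.Exact (pull (X i) (A := M) x) (conn i δ M)
  /-- exactness of `Eⁱ(-, A) ⟶ Eⁱ(-, B) ⟶ Eⁱ(-, Z)` -/
  exact₁' : ∀ (i : ℕ) {A B Z : C} (x : A ⟶ B) (y : B ⟶ Z) (δ : val T.E Z A), T.Realizes x y δ →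
    ∀ M : C, Function.Exact (push (X i) (Z := M) x) (push (X i) (Z := M) y)
  /-- exactness of `Eⁱ(-, B) ⟶ Eⁱ(-, Z) ⟶ Eⁱ⁺¹(-, A)` -/
  exact₂' : ∀ (i : ℕ) {A B Z : C} (x : A ⟶ B) (y : B ⟶ Z) (δ : val T.E Z A), T.Realizes x y δ →
    ∀ M : C, Function.Exact (push (X i) (Z := M) y) (conn' i δ M)
  /-- `∂` is compatible with morphisms of `E`-triangles -/
  conn_comp : ∀ (i : ℕ) {Z A Z' A' : C} (δ : val T.E Z A) (δ' : val T.E Z' A') (a : A ⟶ A')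
    (c : Z ⟶ Z'), push T.E a δ = pull T.E c δ' → ∀ (M : C) (η : val (X i) A' M),
    conn i δ M (pull (X i) a η) = pull (X (i + 1)) c (conn i δ' M η)
  /-- `Δ` is compatible with morphisms of `E`-triangles -/
  conn'_comp : ∀ (i : ℕ) {Z A Z' A' : C} (δ : val T.E Z A) (δ' : val T.E Z' A') (a : A ⟶ A')
    (c : Z ⟶ Z'), push T.E a δ = pull T.E c δ' → ∀ (M : C) (η : val (X i) M Z),
    push (X (i + 1)) a (conn' i δ M η) = conn' i δ' M (push (X i) c η)
  /-- projective morphisms act as zero -/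
  proj : ∀ (i : ℕ) {U V : C} (f : U ⟶ V), T.IsProjMor f → ∀ (M : C) (η : val (X i) V M),
    pull (X i) f η = 0
  /-- injective morphisms act as zero -/
  inj : ∀ (i : ℕ) {U V : C} (g : U ⟶ V), T.IsInjMor g → ∀ (M : C) (η : val (X i) M U),
    push (X i) g η = 0

/-! #### Coresolutions and the categories `𝒳ₙ^∨` -/

/-- `M` has a finite `𝒳`-coresolution of length `k`: a sequence of conflations
`M ⟶ Y₀ ⟶ M₁`, `M₁ ⟶ Y₁ ⟶ M₂`, …, that ends with an isomorphism `Mₖ ≅ Yₖ`, where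
`Y₀, …, Yₖ` lie in `𝒳`. -/
def HasCores (𝒳 : ObjectProperty C) : ℕ → ObjectProperty C
  | 0 => fun M => ∃ Y : C, 𝒳 Y ∧ Nonempty (M ≅ Y)
  | k + 1 => fun M => ∃ (Y M' : C) (x : M ⟶ Y) (y : Y ⟶ M'),
      𝒳 Y ∧ T.Conflation x y ∧ HasCores 𝒳 k M'

/-- The class `𝒳ₙ^∨` of the objects of `𝒳`-coresolution dimension at most `n`. -/
def coresLE (𝒳 : ObjectProperty C) (n : ℕ) : ObjectProperty C := fun M =>
  ∃ k ≤ n, T.HasCores 𝒳 k M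

/-- `𝒳ₙ^∨` as a full subcategory. -/
abbrev Vee (𝒳 : ObjectProperty C) (n : ℕ) : Type u := (T.coresLE 𝒳 n).FullSubcategory

lemma pull_zero_hom {Y Z A : C} (η : val T.E Z A) : pull T.E (0 : Y ⟶ Z) η = 0 := by
  have := T.additive_left
  dsimp only [pull]
  rw [op_zero, Functor.map_zero]
  rfl

lemma pull_add_hom {Y Z A : C} (f g : Y ⟶ Z) (η : val T.E Z A) :
    pull T.E (f + g) η = pull T.E f η + pull T.E g η := by
  have := T.additive_left
  dsimp only [pull]
  rw [op_add, Functor.map_add]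
  rfl

lemma pull_neg_hom {Y Z A : C} (f : Y ⟶ Z) (η : val T.E Z A) :
    pull T.E (-f) η = -pull T.E f η := by
  have := T.additive_left
  dsimp only [pull]
  rw [op_neg, Functor.map_neg]
  rfl

lemma push_add_hom {Z A B : C} (f g : A ⟶ B) (η : val T.E Z A) :
    push T.E (f + g) η = push T.E f η + push T.E g η := by
  have := T.additive_right (op Z)
  dsimp only [push]
  rw [Functor.map_add]
  rfl

/-- The ideal of the `E`-projective morphisms between objects of a full subcategory. -/
def projIdeal (P : ObjectProperty C) : CatIdeal P.FullSubcategory where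
  hom U V :=
    { carrier := {f | T.IsProjMor f.hom}
      zero_mem' := fun A δ => T.pull_zero_hom δ
      add_mem' := fun {f g} hf hg A δ => by
        refine (T.pull_add_hom f.hom g.hom δ).trans ?_
        rw [hf A δ, hg A δ, add_zero]
      neg_mem' := fun {f} hf A δ => by
        refine (T.pull_neg_hom f.hom δ).trans ?_
        rw [hf A δ, neg_zero] }
  comp_left {_ _ _} f {g} hg A δ := by
    refine (pull_comp T.E f.hom g.hom δ).trans ?_
    rw [hg A δ, map_zero]
  comp_right {_ _ _ f} g hf A δ := (pull_comp T.E f.hom g.hom δ).trans (hf A _)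

/-! #### The functors `ℍ` and `𝔽` -/

section Functors

variable (𝒳 : ObjectProperty C) (n : ℕ)

/-- The stable category of `𝒳ₙ^∨`: the quotient by the ideal of the `E`-projective morphisms. -/
abbrev Stable : Type u := (T.projIdeal (T.coresLE 𝒳 n)).Quot

/-- The functor `E(-, M)` restricted to `𝒳ₙ^∨`. -/
abbrev restrE (M : C) : (T.Vee 𝒳 n)ᵒᵖ ⥤ AddCommGrpCat.{u} :=
  (T.coresLE 𝒳 n).ι.op ⋙ T.E.flip.obj M

lemma restrE_rel (M : C) {U V : T.Vee 𝒳 n} (f g : U ⟶ V)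
    (h : (T.projIdeal (T.coresLE 𝒳 n)).rel f g) :
    (T.restrE 𝒳 n M).map f.op = (T.restrE 𝒳 n M).map g.op := by
  ext δ
  have h₁ := T.pull_add_hom (f.hom - g.hom) g.hom δ
  rw [sub_add_cancel] at h₁
  have h₂ : pull T.E (f.hom - g.hom) δ = 0 := h M δ
  rw [h₂, zero_add] at h₁
  exact h₁

/-- The contravariant functor on the stable category of `𝒳ₙ^∨` induced by `E(-, M)`. -/
def stableE (M : C) : (T.Stable 𝒳 n)ᵒᵖ ⥤ AddCommGrpCat.{u} :=
  (CategoryTheory.Quotient.lift _ (T.restrE 𝒳 n M).rightOp fun _ _ f g h =>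
    congrArg Quiver.Hom.op (T.restrE_rel 𝒳 n M f g h)).leftOp

instance (M : C) : (T.stableE 𝒳 n M).Additive where
  map_add {X Y f g} := by
    obtain ⟨f⟩ := f
    obtain ⟨g⟩ := g
    obtain ⟨f, rfl⟩ := (T.projIdeal (T.coresLE 𝒳 n)).proj.map_surjective f
    obtain ⟨g, rfl⟩ := (T.projIdeal (T.coresLE 𝒳 n)).proj.map_surjective g
    ext δ
    exact T.pull_add_hom f.hom g.hom δ

/-- The natural transformation induced by `E(-, h)`. -/
def stableEMap {M N : C} (h : M ⟶ N) : T.stableE 𝒳 n M ⟶ T.stableE 𝒳 n N where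
  app Y := (T.E.obj (op Y.unop.as.obj)).map h
  naturality {X Y} f := by
    obtain ⟨f⟩ := f
    obtain ⟨f, rfl⟩ := (T.projIdeal (T.coresLE 𝒳 n)).proj.map_surjective f
    exact ((T.E.map f.hom.op).naturality h).symm

/-- The functor `ℍ : 𝒳ₙ₊₁^∨ ⥤ Mod (stable category of 𝒳ₙ^∨)`, `M ↦ E(-, M)`. -/
def functorH : T.Vee 𝒳 (n + 1) ⥤ RightMod (T.Stable 𝒳 n) where
  obj M := AdditiveFunctor.of (T.stableE 𝒳 n M.obj)
  map h := ObjectProperty.homMk (T.stableEMap 𝒳 n h.hom)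
  map_id M := by
    ext Y δ
    exact push_id T.E δ
  map_comp h k := by
    ext Y δ
    exact push_comp T.E h.hom k.hom δ

instance : (T.functorH 𝒳 n).Additive where
  map_add {M N h k} := by
    ext Y δ
    exact T.push_add_hom h.hom k.hom δ

/-- The ideal `𝒦 = Ker ℍ` of `𝒳ₙ₊₁^∨`: the morphisms `h` with `E(-, h) = 0` on `𝒳ₙ^∨`. -/
def idealK : CatIdeal (T.Vee 𝒳 (n + 1)) := kerIdeal (T.functorH 𝒳 n)

/-- The functor `𝔽 : 𝒳ₙ₊₁^∨/𝒦 ⥤ Mod (stable category of 𝒳ₙ^∨)` induced by `ℍ`. -/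
def functorF : (T.idealK 𝒳 n).Quot ⥤ RightMod (T.Stable 𝒳 n) :=
  CategoryTheory.Quotient.lift _ (T.functorH 𝒳 n) fun _ _ f g h => by
    have h' : (T.functorH 𝒳 n).map (f - g) = 0 := h
    rwa [Functor.map_sub, sub_eq_zero] at h'

instance : (T.functorF 𝒳 n).Additive where
  map_add {M N f g} := by
    obtain ⟨f, rfl⟩ := (T.idealK 𝒳 n).proj.map_surjective f
    obtain ⟨g, rfl⟩ := (T.idealK 𝒳 n).proj.map_surjective g
    exact (T.functorH 𝒳 n).map_add

/-- `𝔽` as a functor to finitely presented modules, once its values are known to be finitely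
presented. -/
def functorFfp (hfp : ∀ M, IsFinPres (T.Stable 𝒳 n) ((T.functorF 𝒳 n).obj M)) :
    (T.idealK 𝒳 n).Quot ⥤ FinPresMod (T.Stable 𝒳 n) :=
  (IsFinPres (T.Stable 𝒳 n)).lift (T.functorF 𝒳 n) hfp

/-- The class `[𝒳]` of the morphisms of `𝒳ₙ₊₁^∨` that factor through an object of `𝒳`. -/
def factorsThrough : MorphismProperty (T.Vee 𝒳 (n + 1)) := fun M N f =>
  ∃ (X : C) (_ : 𝒳 X) (g : M.obj ⟶ X) (h : X ⟶ N.obj), g ≫ h = f.hom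

end Functors

end Extriangulation

end Extriangulated

end Extri

/-!
Let `M` lie in `𝒳ₙ₊₁^∨` and take a conflation `M ⟶ Y ⟶ M'` with extension `δ`, where `Y ∈ 𝒳` and
`M' ∈ 𝒳ₙ^∨` (if `M` is isomorphic to an object of `𝒳`, all claims about `M` are immediate). Everything
follows from the single vanishing statement `E(𝒳ₙ^∨, 𝒳) = 0` (`CoresVanish`) and the exact sequences
that relate `Hom` and `E`:

* every element of `E(U, M)`, `U ∈ 𝒳ₙ^∨`, dies in `E(U, Y) = 0`, so it is a pullback of `δ`; hence
  `Hom(-, Y) ⟶ Hom(-, M') ⟶ E(-, M) ⟶ 0` is a presentation on the stable category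
  (`isFinPres_functorH`);
* a morphism `φ : E(-, M) ⟶ E(-, N)` is determined by `φ(δ)`, which vanishes on `Y` by naturality, so
  `φ(δ) = h · δ` for some `h : M ⟶ N`, and `φ = E(-, h)` (`functorH_full`);
* if `E(-, h) = 0` on `𝒳ₙ^∨`, then `h · δ = 0`, so `h` factors through `Y`; the converse is the
  vanishing again (`idealK_morphisms_eq`).

The vanishing is a dimension shift along a coresolution. It needs only that `Eⁱ(B, X) = 0` and
`Eⁱ⁺¹(Z, X) = 0` imply `Eⁱ(A, X) = 0` for each conflation `A ⟶ B ⟶ Z` (`HasDimensionShift`). For a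
family with connecting morphisms this is part of the axioms. For the coends it comes from the
exactness of `F(B, M) ⟶ F(A, M) ⟶ ∫^X F(X, M) ⊗ E(Z, X)` for every additive half-exact `F`
(`exists_pull_eq_of_coendTmul_eq_zero`), together with the fact that half-exactness passes from `F`
to the coend (`isHalfExact_coendComp`). To see when a tensor vanishes, the coend is compared with the
colimit of the cokernels of `F(B, M) ⟶ F(K, M)` over the conflations `K ⟶ B ⟶ Z` (`shiftRel`): two extensions
of `Z` are dominated by a common one, and a vanishing at a dominating extension is carried back to
`A ⟶ B ⟶ Z` by a pushout of inflations (`exists_pushout`).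
-/

namespace Extri

/-! ### Additivity of bifunctors in the contravariant variable -/

section Bifunctors

variable {C : Type u} [SmallCategory C] [Preadditive C]
  (F : Cᵒᵖ ⥤ C ⥤ AddCommGrpCat.{u}) [F.Additive]

lemma pull_add_apply {Z Z' A : C} (f g : Z' ⟶ Z) (η : val F Z A) :
    pull F (f + g) η = pull F f η + pull F g η := by
  dsimp only [pull]
  rw [op_add, Functor.map_add]
  rfl

lemma pull_sub_apply {Z Z' A : C} (f g : Z' ⟶ Z) (η : val F Z A) :
    pull F (f - g) η = pull F f η - pull F g η := by
  rw [eq_sub_iff_add_eq, ← pull_add_apply, sub_add_cancel]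

lemma pull_zero_apply {Z Z' A : C} (η : val F Z A) :
    pull F (0 : Z' ⟶ Z) η = 0 := by
  rw [← sub_self (0 : Z' ⟶ Z), pull_sub_apply, sub_self]

lemma pull_neg_apply {Z Z' A : C} (f : Z' ⟶ Z) (η : val F Z A) :
    pull F (-f) η = -pull F f η := by
  rw [← zero_sub f, pull_sub_apply, pull_zero_apply, zero_sub]

end Bifunctors

namespace Extriangulation

variable {C : Type u} [SmallCategory C] [Preadditive C] [HasBinaryBiproducts C]
  (T : Extriangulation C)

/-! ### Exact sequences relating `Hom` and `E` -/

lemma push_sub_hom {Z A B : C} (f g : A ⟶ B) (η : val T.E Z A) :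
    push T.E (f - g) η = push T.E f η - push T.E g η := by
  rw [eq_sub_iff_add_eq, ← T.push_add_hom, sub_add_cancel]

lemma push_zero_hom {Z A B : C} (η : val T.E Z A) : push T.E (0 : A ⟶ B) η = 0 := by
  rw [← sub_self (0 : A ⟶ B), T.push_sub_hom, sub_self]

lemma push_fst_inl_add_inr {Z A A' : C} (η : val T.E Z A) (η' : val T.E Z A') :
    push T.E biprod.fst (push T.E biprod.inl η + push T.E biprod.inr η') = η := by
  rw [map_add, ← push_comp, ← push_comp, biprod.inl_fst, biprod.inr_fst, push_id,
    T.push_zero_hom, add_zero]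

lemma push_snd_inl_add_inr {Z A A' : C} (η : val T.E Z A) (η' : val T.E Z A') :
    push T.E biprod.snd (push T.E biprod.inl η + push T.E biprod.inr η') = η' := by
  rw [map_add, ← push_comp, ← push_comp, biprod.inl_snd, biprod.inr_snd, push_id,
    T.push_zero_hom, zero_add]

/-- Every extension is realized by some sequence. -/
lemma exists_realizes {Z A : C} (δ : val T.E Z A) :
    ∃ (B : C) (x : A ⟶ B) (y : B ⟶ Z), T.Realizes x y δ := by
  obtain ⟨S, hS⟩ := Quotient.exists_rep (T.s δ)
  exact ⟨S.mid, S.i, S.p, hS.symm⟩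

end Extriangulation

namespace PreExtriangulation.Realizes

variable {C : Type u} [SmallCategory C] [Preadditive C] [HasBinaryBiproducts C]
  {T : Extriangulation C} {A B Z : C} {x : A ⟶ B} {y : B ⟶ Z} {δ : val T.E Z A}

/-- Sequences isomorphic to a realizing sequence realize the same extension. -/
lemma of_iso (h : T.Realizes x y δ) {B' : C} (b : B ≅ B') {x' : A ⟶ B'} {y' : B' ⟶ Z}
    (hx : x ≫ b.hom = x') (hy : b.hom ≫ y' = y) : T.Realizes x' y' δ :=
  Eq.trans h (Quotient.sound ⟨b, hx, hy⟩)

lemma pull_eq_zero (h : T.Realizes x y δ) : pull T.E y δ = 0 := by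
  obtain ⟨a, ha, -⟩ := T.et3_op (T.realizes_zero A B) h biprod.snd y rfl
  rw [← ha, map_zero]

/-- Exactness of `Hom(B, N) ⟶ Hom(A, N) ⟶ E(Z, N)`. -/
lemma exists_extension (h : T.Realizes x y δ) {N : C} (f : A ⟶ N)
    (hf : push T.E f δ = 0) : ∃ g : B ⟶ N, x ≫ g = f := by
  obtain ⟨b, hb, -⟩ := T.realization h (T.realizes_zero N Z) f (𝟙 Z) (by rw [hf, map_zero])
  exact ⟨b ≫ biprod.fst, by rw [← Category.assoc, hb]; simp⟩

/-- Exactness of `Hom(U, B) ⟶ Hom(U, Z) ⟶ E(U, A)`. -/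
lemma exists_lift (h : T.Realizes x y δ) {U : C} (f : U ⟶ Z)
    (hf : pull T.E f δ = 0) : ∃ g : U ⟶ B, g ≫ y = f := by
  obtain ⟨b, -, hb⟩ := T.realization (T.realizes_zero A U) h (𝟙 A) f (by rw [hf, map_zero])
  exact ⟨biprod.inr ≫ b, by rw [Category.assoc, ← hb]; simp⟩

/-- Exactness of `Hom(A, N) ⟶ E(Z, N) ⟶ E(B, N)`. -/
lemma exists_push_eq (h : T.Realizes x y δ) {N : C} (ε : val T.E Z N)
    (hε : pull T.E y ε = 0) : ∃ f : A ⟶ N, push T.E f δ = ε := by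
  obtain ⟨D, i, p, hD⟩ := T.exists_realizes ε
  obtain ⟨g, hg⟩ := hD.exists_lift y hε
  obtain ⟨a, ha, -⟩ := T.et3_op h hD g (𝟙 Z) (by rw [hg, Category.comp_id])
  exact ⟨a, by rw [ha, pull_id]⟩

/-- Exactness of `Hom(U, Z) ⟶ E(U, A) ⟶ E(U, B)`. -/
lemma exists_pull_eq (h : T.Realizes x y δ) {U : C} (ε : val T.E U A)
    (hε : push T.E x ε = 0) : ∃ f : U ⟶ Z, pull T.E f δ = ε := by
  obtain ⟨D, i, p, hD⟩ := T.exists_realizes ε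
  obtain ⟨g, hg⟩ := hD.exists_extension x hε
  obtain ⟨c, hc, -⟩ := T.et3 hD h (𝟙 A) g (by rw [hg, Category.id_comp])
  exact ⟨c, by rw [← hc, push_id]⟩

/-- The pushout of an inflation `x : A ⟶ B` along `a : A ⟶ A'`: the morphism `(x, -a)` is again
an inflation, and its deflation `q : B ⊞ A' ⟶ W` makes `A' ⟶ W` factor through the first morphism
of every sequence that realizes `a · δ`. -/
lemma exists_pushout [HasZeroObject C] (h : T.Realizes x y δ) {A' B' : C} (a : A ⟶ A')
    {x' : A' ⟶ B'} {y' : B' ⟶ Z} (h' : T.Realizes x' y' (push T.E a δ)) :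
    ∃ (W : C) (q : B ⊞ A' ⟶ W) (δ' : val T.E W A) (u : B' ⟶ W),
      T.Realizes (biprod.lift x (-a)) q δ' ∧ x' ≫ u = biprod.inr ≫ q := by
  -- The morphism `(x, -a)` is the split inflation `(1, -a)` followed by `x ⊞ 1`.
  let b : A ⊞ A' ≅ A ⊞ A' :=
    { hom := biprod.lift biprod.fst (biprod.snd - biprod.fst ≫ a)
      inv := biprod.lift biprod.fst (biprod.snd + biprod.fst ≫ a)
      hom_inv_id := by ext <;> simp
      inv_hom_id := by ext <;> simp }
  have h₁ : T.Realizes (biprod.lift (𝟙 A) (-a)) (biprod.desc a (𝟙 A')) 0 :=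
    (show T.Realizes _ _ _ from T.realizes_zero A A').of_iso b
      (by ext <;> simp [b]) (by ext <;> simp [b])
  obtain ⟨O, hO⟩ := HasZeroObject.zero (C := C)
  have h₂ : T.Realizes (𝟙 A') (0 : A' ⟶ O) 0 :=
    (show T.Realizes _ _ _ from T.realizes_zero A' O).of_iso
      { hom := biprod.fst
        inv := biprod.inl
        hom_inv_id := by
          ext
          · simp
          · simp
          · exact hO.eq_of_src _ _
          · exact hO.eq_of_src _ _
        inv_hom_id := by simp } (by simp) (hO.eq_of_tgt _ _)
  obtain ⟨W, q, d, e, δ', hq, -, hr, hd, -, -⟩ := T.et4 h₁ (T.realizes_sum h h₂)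
  have hδ : push T.E (𝟙 A') (push T.E a δ) = pull T.E biprod.inl
      (push T.E (biprod.desc a (𝟙 A')) (T.extSum δ (0 : val T.E O A'))) := by
    rw [push_id, ← push_pull, PreExtriangulation.extSum, map_add, ← pull_comp, ← pull_comp,
      biprod.inl_fst, pull_id, map_zero, map_zero, add_zero, ← push_comp,
      biprod.inl_desc]
  obtain ⟨u, hu, -⟩ := T.realization h' hd (𝟙 A') biprod.inl hδ
  refine ⟨W, q, δ', u, ?_, ?_⟩
  · convert hr using 1
    ext <;> simp
  · rw [hu, Category.id_comp]
    simpa using (biprod.inr ≫= hq).symm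

end PreExtriangulation.Realizes

/-! ### Elements of the coend -/

section Coend

variable {C : Type u} [SmallCategory C] (F G : Cᵒᵖ ⥤ C ⥤ AddCommGrpCat.{u})

/-- The class of `η ⊗ θ` in the coend `∫^X F(X, A) ⊗ G(Z, X)`. -/
abbrev coendTmul {Z A X : C} (η : val F X A) (θ : val G Z X) : val (coendComp F G) Z A :=
  (QuotientAddGroup.mk (.of ⟨X, η, θ⟩) : CoendVal F G Z A)

lemma coend_mk_eq_zero {Z A : C} {t : FreeAbelianGroup (CoendGen F G Z A)}
    (h : CoendRel F G Z A t) : (QuotientAddGroup.mk t : CoendVal F G Z A) = 0 :=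
  (QuotientAddGroup.eq_zero_iff t).2 (AddSubgroup.subset_closure h)

lemma coendTmul_add_left {Z A X : C} (η η' : val F X A) (θ : val G Z X) :
    coendTmul F G (η + η') θ = coendTmul F G η θ + coendTmul F G η' θ := by
  have h := coend_mk_eq_zero F G (.add_left (Z := Z) X η η' θ)
  rw [sub_sub] at h
  exact sub_eq_zero.1 h

lemma coendTmul_add_right {Z A X : C} (η : val F X A) (θ θ' : val G Z X) :
    coendTmul F G η (θ + θ') = coendTmul F G η θ + coendTmul F G η θ' := by
  have h := coend_mk_eq_zero F G (.add_right X η θ θ')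
  rw [sub_sub] at h
  exact sub_eq_zero.1 h

lemma coendTmul_balanced {Z A X Y : C} (f : X ⟶ Y) (η : val F Y A) (θ : val G Z X) :
    coendTmul F G (pull F f η) θ = coendTmul F G η (push G f θ) :=
  sub_eq_zero.1 (coend_mk_eq_zero F G (.balanced X Y f η θ))

lemma coendTmul_zero_left {Z A X : C} (θ : val G Z X) :
    coendTmul F G (0 : val F X A) θ = 0 := by
  have h := coendTmul_add_left F G (0 : val F X A) 0 θ
  rwa [add_zero, left_eq_add] at h

lemma pull_coendTmul {Z Z' A X : C} (c : Z' ⟶ Z) (η : val F X A) (θ : val G Z X) :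
    pull (coendComp F G) c (coendTmul F G η θ) = coendTmul F G η (pull G c θ) := by
  refine (coendMap_mk F G c (𝟙 A) ⟨X, η, θ⟩).trans ?_
  rw [coendGenMap, push_id]

end Coend

namespace Extriangulation

variable {C : Type u} [SmallCategory C] [Preadditive C] [HasBinaryBiproducts C]
  (T : Extriangulation C) (F : Cᵒᵖ ⥤ C ⥤ AddCommGrpCat.{u})

/-- Every element of the coend is a single tensor: two tensors are added over the biproduct of
the objects on which they live. -/
lemma exists_coendTmul_eq [F.Additive] {Z A : C} (t : val (coendComp F T.E) Z A) :
    ∃ (X : C) (η : val F X A) (θ : val T.E Z X), coendTmul F T.E η θ = t := by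
  obtain ⟨t, rfl⟩ := QuotientAddGroup.mk_surjective t
  induction t using FreeAbelianGroup.induction_on with
  | zero => exact ⟨Z, 0, 0, coendTmul_zero_left F T.E _⟩
  | of g => exact ⟨g.1, g.2.1, g.2.2, rfl⟩
  | neg g _ =>
    have h : coendTmul F T.E (-g.2.1) g.2.2 = -coendTmul F T.E g.2.1 g.2.2 :=
      eq_neg_of_add_eq_zero_left (by
        rw [← coendTmul_add_left, neg_add_cancel, coendTmul_zero_left])
    exact ⟨g.1, -g.2.1, g.2.2, h⟩
  | add t t' h h' =>
    obtain ⟨X, η, θ, h⟩ := h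
    obtain ⟨X', η', θ', h'⟩ := h'
    refine ⟨X ⊞ X', pull F biprod.fst η + pull F biprod.snd η',
      push T.E biprod.inl θ + push T.E biprod.inr θ', ?_⟩
    rw [coendTmul_add_left, coendTmul_balanced, coendTmul_balanced, T.push_fst_inl_add_inr,
      T.push_snd_inl_add_inr, h, h']
    rfl

instance coendComp_additive [F.Additive] : (coendComp F T.E).Additive where
  map_add {Z Z' f g} := by
    ext A t
    obtain ⟨X, η, θ, rfl⟩ := T.exists_coendTmul_eq F t
    refine (pull_coendTmul F T.E (f + g).unop η θ).trans ?_
    rw [unop_add, T.pull_add_hom, coendTmul_add_right, ← pull_coendTmul, ← pull_coendTmul]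
    rfl

/-- Half-exactness of a bifunctor in its contravariant variable: every sequence
`A ⟶ B ⟶ Z` that realizes an extension gives an exact sequence `F(Z, M) ⟶ F(B, M) ⟶ F(A, M)`.
Only the inclusion of the kernel in the image is recorded. -/
def IsHalfExact : Prop :=
  ∀ {A B Z : C} {x : A ⟶ B} {y : B ⟶ Z} {δ : val T.E Z A}, T.Realizes x y δ →
    ∀ {M : C} (η : val F B M), pull F x η = 0 → ∃ ζ : val F Z M, pull F y ζ = η

/-- If the pullback of `θ ∈ E(B, M)` along `A ⟶ B` is zero, then the inflation `M ⟶ W` that (ET4)ᵒᵖ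
attaches to `θ` and `A ⟶ B ⟶ Z` has a retraction, and the retraction pushes the extension in
`E(Z, W)` to a preimage of `θ`. -/
lemma isHalfExact_E : T.IsHalfExact T.E := by
  intro A B Z x y δ h M θ hθ
  obtain ⟨D, i, p, hD⟩ := T.exists_realizes θ
  obtain ⟨W, q, d, e, δ', -, -, -, hd, -, hδ'⟩ := T.et4_op hD h
  obtain ⟨r, hr⟩ := (show T.Realizes d e _ from hd).exists_extension (𝟙 M) (by rw [hθ, map_zero])
  refine ⟨push T.E r δ', ?_⟩
  rw [← push_pull, ← hδ', ← push_comp, hr, push_id]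

/-! ### The relation that detects vanishing in the coend -/

section ShiftRel

variable {F}
variable {Z K B : C} (κ : val T.E Z K) (k : K ⟶ B) (M : C)

variable (F) in
/-- For an extension `κ ∈ E(Z, K)` with inflation `k : K ⟶ B`, the relation between formal sums of
generators of `∫^X F(X, M) ⊗ E(Z, X)` and elements of `F(K, M)` that moves a generator
`η ⊗ (f · κ)` to `η · f`, modulo the image of `F(B, M)`. -/
def shiftRel : AddSubgroup (FreeAbelianGroup (CoendGen F T.E Z M) × val F K M) :=
  AddSubgroup.closure
    ({p | ∃ (X : C) (η : val F X M) (f : K ⟶ X), p = (.of ⟨X, η, push T.E f κ⟩, pull F f η)} ∪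
      {p | ∃ b : val F B M, p = (0, pull F k b)})

variable {T κ k M}

lemma of_mem_shiftRel {X : C} (η : val F X M) (f : K ⟶ X) {θ : val T.E Z X}
    (hθ : push T.E f κ = θ) :
    (.of ⟨X, η, θ⟩, pull F f η) ∈ T.shiftRel F κ k M :=
  AddSubgroup.subset_closure (.inl ⟨X, η, f, by rw [hθ]⟩)

/-- The relation can be transported to every extension that dominates the given one. -/
lemma shiftRel_mono {y : B ⟶ Z} (h : T.Realizes k y κ) {K' B' : C} {k' : K' ⟶ B'} {y' : B' ⟶ Z}
    {κ' : val T.E Z K'} (h' : T.Realizes k' y' κ') (g : K' ⟶ K) (hg : push T.E g κ' = κ)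
    {t : FreeAbelianGroup (CoendGen F T.E Z M)} {ξ : val F K M}
    (ht : (t, ξ) ∈ T.shiftRel F κ k M) : (t, pull F g ξ) ∈ T.shiftRel F κ' k' M := by
  obtain ⟨b, hb, -⟩ := T.realization h' h g (𝟙 Z) (by rw [hg, pull_id])
  suffices T.shiftRel F κ k M ≤ (T.shiftRel F κ' k' M).comap
      ((AddMonoidHom.id _).prodMap (pull F g)) from this ht
  refine (AddSubgroup.closure_le _).2 ?_
  rintro _ (⟨X, η, f, rfl⟩ | ⟨η, rfl⟩)
  · have := of_mem_shiftRel (k := k') η (g ≫ f) (by rw [push_comp, hg])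
    rwa [pull_comp] at this
  · refine AddSubgroup.subset_closure (.inr ⟨pull F b η, ?_⟩)
    rw [← pull_comp, hb, pull_comp]
    rfl

/-- The relation determines the element of `F(K, M)` modulo the image of `F(B, M)`. -/
lemma exists_pull_eq_of_mem_shiftRel [F.Additive] {y : B ⟶ Z} (h : T.Realizes k y κ) {X : C}
    {η : val F X M} (f : K ⟶ X)
    (ht : (.of ⟨X, η, push T.E f κ⟩, 0) ∈ T.shiftRel F κ k M) :
    ∃ b : val F B M, pull F k b = pull F f η := by
  classical
  let N : AddSubgroup (val F K M) := (pull F k).range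
  -- `η · f` does not depend, modulo `N`, on the `f` with `f · κ = θ`: two of them differ by a
  -- morphism that factors through `k`.
  have key : ∀ (X : C) (η : val F X M) (f f' : K ⟶ X), push T.E f κ = push T.E f' κ →
      (QuotientAddGroup.mk (pull F f η) : val F K M ⧸ N) = QuotientAddGroup.mk (pull F f' η) := by
    intro X η f f' hf
    obtain ⟨g, hg⟩ := h.exists_extension (f' - f) (by rw [T.push_sub_hom, hf, sub_self])
    refine QuotientAddGroup.eq.2 ⟨pull F g η, ?_⟩
    rw [← pull_comp, hg, pull_sub_apply, neg_add_eq_sub]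
  let φ : FreeAbelianGroup (CoendGen F T.E Z M) →+ val F K M ⧸ N :=
    FreeAbelianGroup.lift fun g =>
      if hg : ∃ f : K ⟶ g.1, push T.E f κ = g.2.2 then
        QuotientAddGroup.mk (pull F hg.choose g.2.1) else 0
  have hφ : ∀ (X : C) (η : val F X M) (f : K ⟶ X),
      φ (.of ⟨X, η, push T.E f κ⟩) = QuotientAddGroup.mk (pull F f η) := by
    intro X η f
    have hg : ∃ f' : K ⟶ X, push T.E f' κ = push T.E f κ := ⟨f, rfl⟩
    rw [FreeAbelianGroup.lift_apply_of, dif_pos hg]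
    exact key X η _ f hg.choose_spec
  have hle : T.shiftRel F κ k M ≤ (φ.comp (AddMonoidHom.fst _ _)).eqLocus
      ((QuotientAddGroup.mk' N).comp (AddMonoidHom.snd _ _)) := by
    refine (AddSubgroup.closure_le _).2 ?_
    rintro _ (⟨X, η, f, rfl⟩ | ⟨η, rfl⟩)
    · exact hφ X η f
    · refine (map_zero φ).trans (Eq.symm ?_)
      exact (QuotientAddGroup.eq_zero_iff _).2 ⟨η, rfl⟩
  have h₀ := (hφ X η f).symm.trans (hle ht)
  exact (QuotientAddGroup.eq_zero_iff _).1 (h₀.trans (map_zero (QuotientAddGroup.mk' N)))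

/-- A formal sum that vanishes in the coend is related to `0` for some extension: every defining
relation is, and two extensions are dominated by their sum along the diagonal. -/
lemma exists_mem_shiftRel_of_mem_coendSub [F.Additive]
    {t : FreeAbelianGroup (CoendGen F T.E Z M)} (ht : t ∈ coendSub F T.E Z M) :
    ∃ (K B : C) (κ : val T.E Z K) (k : K ⟶ B) (y : B ⟶ Z), T.Realizes k y κ ∧
      (t, 0) ∈ T.shiftRel F κ k M := by
  induction ht using AddSubgroup.closure_induction with
  | mem t ht =>
    cases ht with
    | add_left X η η' θ =>
      obtain ⟨B, k, y, h⟩ := T.exists_realizes θ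
      refine ⟨X, B, θ, k, y, h, ?_⟩
      have := sub_mem (sub_mem (of_mem_shiftRel (k := k) (η + η') (𝟙 X) (push_id T.E θ))
        (of_mem_shiftRel (k := k) η (𝟙 X) (push_id T.E θ)))
        (of_mem_shiftRel (k := k) η' (𝟙 X) (push_id T.E θ))
      simpa [pull_id] using this
    | add_right X η θ θ' =>
      let κ : val T.E Z (X ⊞ X) := push T.E biprod.inl θ + push T.E biprod.inr θ'
      have h₁ : push T.E biprod.fst κ = θ := T.push_fst_inl_add_inr _ _
      have h₂ : push T.E biprod.snd κ = θ' := T.push_snd_inl_add_inr _ _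
      obtain ⟨B, k, y, h⟩ := T.exists_realizes κ
      refine ⟨X ⊞ X, B, κ, k, y, h, ?_⟩
      have := sub_mem (sub_mem (of_mem_shiftRel (k := k) η (biprod.fst + biprod.snd)
          (by rw [T.push_add_hom, h₁, h₂]))
        (of_mem_shiftRel (k := k) η biprod.fst h₁))
        (of_mem_shiftRel (k := k) η biprod.snd h₂)
      rw [pull_add_apply] at this
      simpa using this
    | balanced X Y f η θ =>
      obtain ⟨B, k, y, h⟩ := T.exists_realizes θ
      refine ⟨X, B, θ, k, y, h, ?_⟩
      have := sub_mem (of_mem_shiftRel (k := k) (pull F f η) (𝟙 X) (push_id T.E θ))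
        (of_mem_shiftRel (k := k) η f rfl)
      simpa [pull_id] using this
  | zero =>
    obtain ⟨B, k, y, h⟩ := T.exists_realizes (0 : val T.E Z Z)
    exact ⟨Z, B, 0, k, y, h, zero_mem _⟩
  | neg t _ ht =>
    obtain ⟨K, B, κ, k, y, h, ht⟩ := ht
    exact ⟨K, B, κ, k, y, h, by simpa using neg_mem ht⟩
  | add t t' _ _ ht ht' =>
    obtain ⟨K, B, κ, k, y, h, ht⟩ := ht
    obtain ⟨K', B', κ', k', y', h', ht'⟩ := ht'
    obtain ⟨D, i, p, hD⟩ := T.exists_realizes (push T.E biprod.inl κ + push T.E biprod.inr κ' :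
      val T.E Z (K ⊞ K'))
    refine ⟨_, D, _, i, p, hD, ?_⟩
    have := add_mem
      (shiftRel_mono h hD biprod.fst (T.push_fst_inl_add_inr _ _) ht)
      (shiftRel_mono h' hD biprod.snd (T.push_snd_inl_add_inr _ _) ht')
    simpa using this

end ShiftRel

variable {F}

/-- Exactness of `F(B, M) ⟶ F(A, M) ⟶ ∫^X F(X, M) ⊗ E(Z, X)` for a half-exact `F`, where the second
morphism is `η ↦ η ⊗ δ`. -/
lemma exists_pull_eq_of_coendTmul_eq_zero [HasZeroObject C] [F.Additive] (hF : T.IsHalfExact F)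
    {A B Z M : C} {x : A ⟶ B} {y : B ⟶ Z} {δ : val T.E Z A} (h : T.Realizes x y δ)
    {η : val F A M} (hη : coendTmul F T.E η δ = 0) : ∃ b : val F B M, pull F x b = η := by
  obtain ⟨K, D, κ, k, p, hk, ht⟩ :=
    exists_mem_shiftRel_of_mem_coendSub ((QuotientAddGroup.eq_zero_iff _).1 hη)
  let κ' : val T.E Z (K ⊞ A) := push T.E biprod.inl κ + push T.E biprod.inr δ
  have h₁ : push T.E biprod.fst κ' = κ := T.push_fst_inl_add_inr _ _
  have h₂ : push T.E biprod.snd κ' = δ := T.push_snd_inl_add_inr _ _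
  obtain ⟨D', k', p', hk'⟩ := T.exists_realizes κ'
  have ht' := shiftRel_mono hk hk' biprod.fst h₁ ht
  rw [map_zero, ← h₂] at ht'
  obtain ⟨b, hb⟩ := exists_pull_eq_of_mem_shiftRel hk' biprod.snd ht'
  -- `(b, η)` vanishes on `K ⊞ A`, so it comes from the pushout of `k'` along the projection to `A`.
  obtain ⟨W, q, δ', u, hq, hu⟩ :=
    (show T.Realizes k' p' κ' from hk').exists_pushout biprod.snd (h₂ ▸ h)
  obtain ⟨ζ, hζ⟩ := hF hq (pull F biprod.fst b + pull F biprod.snd η) (by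
    rw [map_add, ← pull_comp, ← pull_comp, biprod.lift_fst, biprod.lift_snd, pull_neg_apply, hb,
      add_neg_cancel])
  refine ⟨pull F u ζ, ?_⟩
  rw [← pull_comp, hu, pull_comp, hζ, map_add, ← pull_comp, ← pull_comp, biprod.inr_fst,
    biprod.inr_snd, pull_id, pull_zero_apply, zero_add]

/-- A tensor `η ⊗ θ` that vanishes on `A` has an `η` that extends to the middle term of the
pullback of `θ` to `A`; by (ET4)ᵒᵖ that middle term carries an extension of `Z`. -/
lemma isHalfExact_coendComp [HasZeroObject C] [F.Additive] (hF : T.IsHalfExact F) :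
    T.IsHalfExact (coendComp F T.E) := by
  intro A B Z x y δ h M t ht
  obtain ⟨X, η, θ, rfl⟩ := T.exists_coendTmul_eq F t
  rw [pull_coendTmul] at ht
  obtain ⟨D, i, p, hD⟩ := T.exists_realizes θ
  obtain ⟨W, q, d, e, δ', -, -, -, hd, -, hδ'⟩ := T.et4_op hD h
  obtain ⟨ω, rfl⟩ := T.exists_pull_eq_of_coendTmul_eq_zero hF hd ht
  refine ⟨coendTmul F T.E ω δ', ?_⟩
  rw [pull_coendTmul, ← hδ', ← coendTmul_balanced]

lemma coendExt_additive_and_isHalfExact [HasZeroObject C] (i : ℕ) :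
    (T.coendExt i).Additive ∧ T.IsHalfExact (T.coendExt i) := by
  induction i with
  | zero => exact ⟨T.additive_left, T.isHalfExact_E⟩
  | succ i ih =>
    have := ih.1
    exact ⟨T.coendComp_additive _, T.isHalfExact_coendComp ih.2⟩

/-! ### Dimension shifting -/

/-- The only consequence of the long exact sequences that matters: if `Eⁱ(B, M) = 0` and
`Eⁱ⁺¹(Z, M) = 0`, then `Eⁱ(A, M) = 0`. -/
def HasDimensionShift (Ext : ℕ → (Cᵒᵖ ⥤ C ⥤ AddCommGrpCat.{u})) : Prop :=
  ∀ (i : ℕ) {A B Z : C} {x : A ⟶ B} {y : B ⟶ Z} {δ : val T.E Z A}, T.Realizes x y δ →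
    ∀ M : C, (∀ η : val (Ext i) B M, η = 0) → (∀ η : val (Ext (i + 1)) Z M, η = 0) →
      ∀ η : val (Ext i) A M, η = 0

variable {T}

lemma HigherExtGroups.hasDimensionShift {Ext : ℕ → (Cᵒᵖ ⥤ C ⥤ AddCommGrpCat.{u})}
    (X : T.HigherExtGroups Ext) : T.HasDimensionShift Ext := by
  intro i A B Z x y δ h M hB hZ η
  obtain ⟨b, rfl⟩ := (X.exact₂ i x y δ h M η).1 (hZ _)
  rw [hB b, map_zero]

lemma hasDimensionShift_coendExt [HasZeroObject C] : T.HasDimensionShift T.coendExt := by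
  intro i A B Z x y δ h M hB hZ η
  obtain ⟨_, hi⟩ := T.coendExt_additive_and_isHalfExact i
  obtain ⟨b, rfl⟩ := T.exists_pull_eq_of_coendTmul_eq_zero hi h
    (hZ (coendTmul (T.coendExt i) T.E η δ))
  rw [hB b, map_zero]

end Extriangulation

/-! ### Finite presentations from pointwise exact sequences -/

section FinPres

/-- In a category of functors to abelian groups, a pointwise epimorphism is a cokernel of every
morphism onto its pointwise kernels. -/
lemma nonempty_cokernel_iso {D : Type u} [Category.{u} D] {P Q G : Dᵒᵖ ⥤ AddCommGrpCat.{u}} (f : P ⟶ Q) (π : Q ⟶ G)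
    (w : f ≫ π = 0) (hπ : ∀ U, Function.Surjective (π.app U))
    (hf : ∀ U (g : Q.obj U), π.app U g = 0 → ∃ h : P.obj U, f.app U h = g) :
    Nonempty (cokernel f ≅ G) := by
  have hc : IsColimit (CokernelCofork.ofπ π w) := by
    refine evaluationJointlyReflectsColimits _ fun U =>
      (CokernelCofork.isColimitMapCoconeEquiv _ _).2 ?_
    let S : ShortComplex AddCommGrpCat.{u} :=
      ⟨f.app U, π.app U, by rw [← NatTrans.comp_app, w]; rfl⟩
    have : Epi S.g := (AddCommGrpCat.epi_iff_surjective _).2 (hπ U)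
    exact (S.ab_exact_iff.2 (hf U)).gIsCokernel
  exact ⟨(cokernelIsCokernel f).coconePointUniqueUpToIso hc⟩

/-- A module with a presentation by two representable functors is finitely presented. -/
lemma isFinPres_of_exact {D : Type u} [Category.{u} D] [Preadditive D] (G : RightMod D)
    {P Q : D} (f : P ⟶ Q)
    (π : preadditiveYoneda.obj Q ⟶ G.obj) (w : preadditiveYoneda.map f ≫ π = 0)
    (hπ : ∀ U, Function.Surjective (π.app U))
    (hf : ∀ (U : D) (g : U ⟶ Q), π.app (op U) g = 0 → ∃ h : U ⟶ P, h ≫ f = g) :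
    IsFinPres D G := by
  let e (R : D) : (∐ fun _ : Fin 1 => preadditiveYoneda.obj R) ≅ preadditiveYoneda.obj R :=
    coproductUniqueIso _
  obtain ⟨i⟩ := nonempty_cokernel_iso (preadditiveYoneda.map f) π w hπ fun U g hg =>
    hf U.unop g hg
  refine ⟨1, 1, fun _ => P, fun _ => Q, (e P).hom ≫ preadditiveYoneda.map f ≫ (e Q).inv, ⟨?_⟩⟩
  exact cokernel.mapIso _ _ (e P) (e Q) (by simp) ≪≫ i

end FinPres

namespace Extriangulation

variable {C : Type u} [SmallCategory C] [Preadditive C] [HasBinaryBiproducts C]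
  {T : Extriangulation C} {𝒳 : ObjectProperty C} {n : ℕ}

/-! ### Objects with finite coresolutions -/

/-- Dimension shifting along a coresolution: `Eⁱ⁺¹(U, 𝒳) = 0` if `U` has a coresolution of
length `k` and `i + k ≤ n`. -/
lemma HasDimensionShift.eq_zero_of_hasCores {Ext : ℕ → (Cᵒᵖ ⥤ C ⥤ AddCommGrpCat.{u})}
    (hExt : T.HasDimensionShift Ext) (h𝒳 : IsRigid Ext n 𝒳) {k : ℕ} :
    ∀ {i : ℕ} {U : C}, i + k ≤ n → T.HasCores 𝒳 k U → ∀ {X : C}, 𝒳 X →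
      ∀ η : val (Ext i) U X, η = 0 := by
  induction k with
  | zero =>
    rintro i U hi ⟨Y, hY, ⟨e⟩⟩ X hX η
    have h : pull (Ext i) e.inv η = 0 := h𝒳 i hi Y X hY hX _
    rw [← pull_id (Ext i) η, ← e.hom_inv_id, pull_comp, h, map_zero]
  | succ k ih =>
    rintro i U hi ⟨Y, U', x, y, hY, ⟨δ, hδ⟩, hU'⟩ X hX
    exact hExt i hδ X (h𝒳 i (by omega) Y X hY hX) (ih (by omega) hU' hX)

variable (T 𝒳 n) in
/-- The vanishing `E(𝒳ₙ^∨, 𝒳) = 0`. -/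
def CoresVanish : Prop :=
  ∀ ⦃U X : C⦄, T.coresLE 𝒳 n U → 𝒳 X → ∀ η : val T.E U X, η = 0

lemma coresVanish_of_isRigid [HasZeroObject C] {Ext : ℕ → (Cᵒᵖ ⥤ C ⥤ AddCommGrpCat.{u})}
    (hExt : Nonempty (T.HigherExtGroups Ext) ∨ Ext = T.coendExt) (h𝒳 : IsRigid Ext n 𝒳) :
    T.CoresVanish 𝒳 n := by
  rintro U X ⟨k, hk, hU⟩ hX
  have h₀ : Ext 0 = T.E ∧ T.HasDimensionShift Ext := by
    obtain ⟨⟨H⟩⟩ | rfl := hExt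
    · exact ⟨H.one, H.hasDimensionShift⟩
    · exact ⟨rfl, hasDimensionShift_coendExt⟩
  rw [← h₀.1]
  exact h₀.2.eq_zero_of_hasCores h𝒳 (by omega) hU hX

lemma coresLE_of_mem {X : C} (hX : 𝒳 X) : T.coresLE 𝒳 n X :=
  ⟨0, n.zero_le, X, hX, ⟨Iso.refl X⟩⟩

/-- An object of `𝒳ₙ₊₁^∨` is isomorphic to an object of `𝒳` or starts a conflation with
middle term in `𝒳` and last term in `𝒳ₙ^∨`. -/
lemma coresLE_succ_cases {M : C} (hM : T.coresLE 𝒳 (n + 1) M) :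
    (∃ Y : C, 𝒳 Y ∧ Nonempty (M ≅ Y)) ∨
      ∃ (Y M' : C) (x : M ⟶ Y) (y : Y ⟶ M') (δ : val T.E M' M),
        𝒳 Y ∧ T.coresLE 𝒳 n M' ∧ T.Realizes x y δ := by
  obtain ⟨_ | k, hk, hM⟩ := hM
  · exact .inl hM
  · obtain ⟨Y, M', x, y, hY, ⟨δ, hδ⟩, hM'⟩ := hM
    exact .inr ⟨Y, M', x, y, δ, hY, ⟨k, by omega, hM'⟩, hδ⟩

lemma CoresVanish.eq_zero_of_iso (h : T.CoresVanish 𝒳 n) {U M Y : C} (hU : T.coresLE 𝒳 n U)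
    (hY : 𝒳 Y) (e : M ≅ Y) (η : val T.E U M) : η = 0 := by
  rw [← push_id T.E η, ← e.hom_inv_id, push_comp, h hU hY (push T.E e.hom η), map_zero]

/-! ### The kernel of `ℍ` -/

lemma mem_idealK_iff {M N : T.Vee 𝒳 (n + 1)} (h : M ⟶ N) :
    h ∈ (T.idealK 𝒳 n).hom M N ↔
      ∀ {U : C}, T.coresLE 𝒳 n U → ∀ θ : val T.E U M.obj, push T.E h.hom θ = 0 := by
  constructor
  · intro hh U hU θ
    have h₁ : (T.functorH 𝒳 n).map h = 0 := hh
    have h₂ : ((T.functorH 𝒳 n).map h).hom.app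
        (op ((T.projIdeal (T.coresLE 𝒳 n)).proj.obj ⟨U, hU⟩)) = 0 := by
      rw [h₁]
      rfl
    exact ConcreteCategory.congr_hom h₂ θ
  · intro hh
    change (T.functorH 𝒳 n).map h = 0
    ext U θ
    exact hh U.unop.as.property θ

lemma idealK_morphisms_eq (hvan : T.CoresVanish 𝒳 n) :
    (T.idealK 𝒳 n).morphisms = T.factorsThrough 𝒳 n := by
  ext M N f
  refine (mem_idealK_iff f).trans ⟨fun hf => ?_, ?_⟩
  · obtain ⟨Y, hY, ⟨e⟩⟩ | ⟨Y, M', x, y, δ, hY, hM', hδ⟩ := coresLE_succ_cases M.property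
    · exact ⟨Y, hY, e.hom, e.inv ≫ f.hom, by simp⟩
    · obtain ⟨g, hg⟩ := hδ.exists_extension f.hom (hf hM' δ)
      exact ⟨Y, hY, x, g, hg⟩
  · rintro ⟨X, hX, g, h, hf⟩ U hU θ
    rw [← hf, push_comp, hvan hU hX (push T.E g θ), map_zero]

/-! ### Finite presentation of the values of `ℍ` -/

/-- The morphism `Hom(-, Z) ⟶ E(-, A)` on the stable category given by an extension
`δ ∈ E(Z, A)`. -/
def stableConn {A : C} {Z : T.Stable 𝒳 n} (δ : val T.E Z.as.obj A) :
    preadditiveYoneda.obj Z ⟶ T.stableE 𝒳 n A where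
  app U := AddCommGrpCat.ofHom
    { toFun := fun (f : U.unop ⟶ Z) => (T.stableE 𝒳 n A).map f.op δ
      map_zero' := ConcreteCategory.congr_hom
        ((T.stableE 𝒳 n A).map_zero (op Z) U) δ
      map_add' := fun (f g : U.unop ⟶ Z) => ConcreteCategory.congr_hom
        ((T.stableE 𝒳 n A).map_add (f := f.op) (g := g.op)) δ }
  naturality U V c := by
    ext f
    exact ConcreteCategory.congr_hom ((T.stableE 𝒳 n A).map_comp (Quiver.Hom.op f) c) δ

lemma isFinPres_functorH (hvan : T.CoresVanish 𝒳 n) (M : T.Vee 𝒳 (n + 1)) :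
    IsFinPres (T.Stable 𝒳 n) ((T.functorH 𝒳 n).obj M) := by
  let p := (T.projIdeal (T.coresLE 𝒳 n)).proj
  obtain ⟨Y, hY, ⟨e⟩⟩ | ⟨Y, M', x, y, δ, hY, hM', hδ⟩ := coresLE_succ_cases M.property
  · let Y' : T.Stable 𝒳 n := p.obj ⟨Y, coresLE_of_mem hY⟩
    refine isFinPres_of_exact _ (𝟙 Y') 0 comp_zero (fun U θ => ⟨0, ?_⟩)
      fun U g _ => ⟨g, Category.comp_id g⟩
    exact (hvan.eq_zero_of_iso U.unop.as.property hY e _).symm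
  · let Y' : T.Vee 𝒳 n := ⟨Y, coresLE_of_mem hY⟩
    let Z : T.Vee 𝒳 n := ⟨M', hM'⟩
    let y' : Y' ⟶ Z := ObjectProperty.homMk y
    refine isFinPres_of_exact _ (p.map y') (stableConn (Z := p.obj Z) δ) ?_ (fun U θ => ?_)
      fun U g hg => ?_
    · ext U f
      obtain ⟨f, rfl⟩ := p.map_surjective f
      change pull T.E (f.hom ≫ y) δ = 0
      rw [pull_comp, hδ.pull_eq_zero, map_zero]
    · obtain ⟨f, hf⟩ := hδ.exists_pull_eq (U := U.unop.as.obj) θ (hvan U.unop.as.property hY _)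
      exact ⟨p.map (ObjectProperty.homMk f : U.unop.as ⟶ Z), hf⟩
    · obtain ⟨g, rfl⟩ := p.map_surjective g
      obtain ⟨f, hf⟩ := hδ.exists_lift g.hom hg
      refine ⟨p.map (ObjectProperty.homMk f : U.as ⟶ Y'), ?_⟩
      rw [← p.map_comp]
      congr 1
      ext
      exact hf

/-! ### Full faithfulness and the kernel ideal -/

/-- A morphism `φ : E(-, M) ⟶ E(-, N)` is determined by its value on the extension `δ` of a
conflation `M ⟶ Y ⟶ M'` with `Y ∈ 𝒳`, since every element of `E(U, M)` is a pullback of `δ`, and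
that value has the form `h · δ`. -/
lemma functorH_full (hvan : T.CoresVanish 𝒳 n) : (T.functorH 𝒳 n).Full where
  map_surjective {M N} φ := by
    let p := (T.projIdeal (T.coresLE 𝒳 n)).proj
    let app (U : T.Vee 𝒳 n) : val T.E U.obj M.obj →+ val T.E U.obj N.obj :=
      (φ.hom.app (op (p.obj U))).hom
    have nat {U V : T.Vee 𝒳 n} (f : U ⟶ V) (θ : val T.E V.obj M.obj) :
        app U (pull T.E f.hom θ) = pull T.E f.hom (app V θ) :=
      ConcreteCategory.congr_hom (φ.hom.naturality (p.map f).op) θ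
    suffices ∃ h : M.obj ⟶ N.obj, ∀ (U : T.Vee 𝒳 n) (θ : val T.E U.obj M.obj),
        push T.E h θ = app U θ by
      obtain ⟨h, hh⟩ := this
      refine ⟨ObjectProperty.homMk h, ?_⟩
      ext U θ
      exact hh U.unop.as θ
    obtain ⟨Y, hY, ⟨e⟩⟩ | ⟨Y, M', x, y, δ, hY, hM', hδ⟩ := coresLE_succ_cases M.property
    · refine ⟨0, fun U θ => ?_⟩
      rw [hvan.eq_zero_of_iso U.property hY e θ, map_zero, map_zero]
    · let Y' : T.Vee 𝒳 n := ⟨Y, coresLE_of_mem hY⟩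
      let Z : T.Vee 𝒳 n := ⟨M', hM'⟩
      have hy : pull T.E y (app Z δ) = 0 := by
        refine (nat (ObjectProperty.homMk y : Y' ⟶ Z) δ).symm.trans ?_
        exact (congrArg _ hδ.pull_eq_zero).trans (map_zero _)
      obtain ⟨h, hh⟩ := hδ.exists_push_eq (app Z δ) hy
      refine ⟨h, fun U θ => ?_⟩
      obtain ⟨f, rfl⟩ := hδ.exists_pull_eq θ (hvan U.property hY _)
      rw [push_pull, hh]
      exact (nat (ObjectProperty.homMk f : U ⟶ Z) δ).symm

lemma functorF_full (hvan : T.CoresVanish 𝒳 n) : (T.functorF 𝒳 n).Full where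
  map_surjective {M N} φ := by
    have := functorH_full hvan
    obtain ⟨h, hh⟩ := (T.functorH 𝒳 n).map_surjective (X := M.as) (Y := N.as) φ
    exact ⟨(T.idealK 𝒳 n).proj.map h, hh⟩

lemma functorF_faithful : (T.functorF 𝒳 n).Faithful where
  map_injective {M N} f g h := by
    obtain ⟨f, rfl⟩ := (T.idealK 𝒳 n).proj.map_surjective f
    obtain ⟨g, rfl⟩ := (T.idealK 𝒳 n).proj.map_surjective g
    have h' : (T.functorH 𝒳 n).map f = (T.functorH 𝒳 n).map g := h
    refine CategoryTheory.Quotient.sound _ (?_ : (T.functorH 𝒳 n).map (f - g) = 0)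
    rw [Functor.map_sub, h', sub_self]

end Extriangulation

end Extri

theorem mainTheorem1 {C : Type u} [SmallCategory C] [Preadditive C] [HasZeroObject C]
    [HasBinaryBiproducts C] (T : Extri.Extriangulation C)
    (Ext : ℕ → (Cᵒᵖ ⥤ C ⥤ AddCommGrpCat.{u}))
    (hExt : Nonempty (T.HigherExtGroups Ext) ∨ Ext = T.coendExt)
    (n : ℕ) (𝒳 : ObjectProperty C) (h𝒳 : Extri.IsRigid Ext n 𝒳) :
    (∃ hfp : ∀ M : (T.idealK 𝒳 n).Quot,
        Extri.IsFinPres (T.Stable 𝒳 n) ((T.functorF 𝒳 n).obj M),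
      (T.functorFfp 𝒳 n hfp).Additive ∧ (T.functorFfp 𝒳 n hfp).Full ∧
        (T.functorFfp 𝒳 n hfp).Faithful) ∧
    (T.idealK 𝒳 n).morphisms = T.factorsThrough 𝒳 n := by
  have hvan := Extri.Extriangulation.coresVanish_of_isRigid hExt h𝒳
  have hfull := Extri.Extriangulation.functorF_full hvan
  have hfaithful := Extri.Extriangulation.functorF_faithful (T := T) (𝒳 := 𝒳) (n := n)
  have hfp (M : (T.idealK 𝒳 n).Quot) :
      Extri.IsFinPres (T.Stable 𝒳 n) ((T.functorF 𝒳 n).obj M) :=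
    Extri.Extriangulation.isFinPres_functorH hvan M.as
  refine ⟨⟨hfp, ?_, ?_, ?_⟩, Extri.Extriangulation.idealK_morphisms_eq hvan⟩
  · refine ⟨fun {M N f g} => ?_⟩
    ext1
    exact (T.functorF 𝒳 n).map_add
  · exact inferInstanceAs ((Extri.IsFinPres (T.Stable 𝒳 n)).lift (T.functorF 𝒳 n) hfp).Full
  · exact inferInstanceAs ((Extri.IsFinPres (T.Stable 𝒳 n)).lift (T.functorF 𝒳 n) hfp).Faithful
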